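/- Let $d\ge 1$ and let $\rho$ be a probability measure on $\mathbb{R}^d$ that is symmetric (invariant under $z\mapsto -z$), with $\int\|z\|^2\,d\rho(z)<\infty$ and with positive definite covariance matrix $\Sigma=\int z\,{}^t\!z\,d\rho(z)$. Denote by $\mathcal{S}_d$ the space of real symmetric $d\times d$ matrices and put \[\Delta^{*}=\{(x,M)\in\mathbb{R}^d\times\mathcal{S}_d : M \text{ positive definite},\ M-x\,{}^t\!x \text{ positive semi-definite}\}.\] For $x_1,\dots,x_n\in\mathbb{R}^d$ let $S_n=\sum_{i=1}^n x_i$ and $T_n=\sum_{i=1}^n x_i\,{}^t\!x_i$, let $D_n^+=\{(x_1,\dots,x_n)\in(\mathbb{R}^d)^n:\det T_n>0\}$, and let \[Z_n=\int_{D_n^+}\exp\Big(\tfrac12\langle T_n^{-1}S_n,S_n\rangle\Big)\prod_{i=1}^n d\rho(x_i).\] Let $\widetilde\nu_n$ be the law of $(S_n/n,T_n/n)$ when $x_1,\dots,x_n$ are i.i.d. with law $\rho$, and let $\widetilde\mu_n$ be the probability measure on $(\mathbb{R}^d)^n$ with density $Z_n^{-1}\exp\big(\tfrac12\langle T_n^{-1}S_n,S_n\rangle\big)\mathbf{1}_{D_n^+}$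 with respect to $\rho^{\otimes n}$ (for $n\ge d$). With the convention $\ln 0=-\infty$: (1) $\displaystyle\liminf_{n\to\infty}\frac1n\ln Z_n\ge 0$. Suppose moreover that $\int\exp(v_0\|z\|^2)\,d\rho(z)<\infty$ for some $v_0>0$ and that $\rho(H)<1/\sqrt{e}$ for every linear hyperplane $H$ of $\mathbb{R}^d$ (a linear subspace of dimension $d-1$). Then: (2) For every closed set $A\subset\mathbb{R}^d\times\mathcal{S}_d$ that does not contain $(0,\Sigma)$, \[\limsup_{n\to\infty}\frac1n\ln\int_{\Delta^{*}\cap A}\exp\Big(\frac{n\langle M^{-1}x,x\rangle}{2}\Big)\,d\widetilde\nu_n(x,M)<0.\] (3) For every open neighbourhood $U$ of $(0,\Sigma)$ in $\mathbb{R}^d\times\mathcal{S}_d$ there are $\varepsilon>0$ and $n_0$ such that $\widetilde\mu_n\big((S_n/n,T_n/n)\notin U\big)\le e^{-n\varepsilon}$ for all $n\ge n_0$. -/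

import Mathlib

open MeasureTheory Filter Topology

noncomputable section

namespace CurieWeissSOC

/-- Vectors of `ℝ^d`, with the Euclidean norm. -/
abbrev Vec (d : ℕ) : Type := EuclideanSpace ℝ (Fin d)

/-- The space `𝒮_d` of real symmetric `d × d` matrices, with the topology (and the Borel
sigma-algebra) inherited from all `d × d` matrices. -/
abbrev SymMatrix (d : ℕ) : Type := {M : Matrix (Fin d) (Fin d) ℝ // M.IsSymm}

instance symMatrixMeasurableSpace (d : ℕ) : MeasurableSpace (SymMatrix d) := borel _

instance symMatrixBorelSpace (d : ℕ) : BorelSpace (SymMatrix d) := ⟨rfl⟩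

/-- The rank-one matrix `z ᵗz`. -/
def outer {d : ℕ} (z : Vec d) : Matrix (Fin d) (Fin d) ℝ :=
  Matrix.vecMulVec z.ofLp z.ofLp

theorem outer_isSymm {d : ℕ} (z : Vec d) : (outer z).IsSymm := by
  ext i j
  simp [outer, Matrix.vecMulVec_apply, mul_comm]

/-- The quadratic form `⟨M⁻¹ x, x⟩`, used for invertible `M` only. -/
def invQuad {d : ℕ} (M : Matrix (Fin d) (Fin d) ℝ) (x : Vec d) : ℝ :=
  (M⁻¹.mulVec x.ofLp) ⬝ᵥ x.ofLp

/-- The covariance matrix `Σ = ∫ z ᵗz dρ(z)` of a symmetric (hence centred) measure `ρ`. -/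
def covMatrix {d : ℕ} (ρ : Measure (Vec d)) : SymMatrix d :=
  ⟨Matrix.of fun i j => ∫ z, z i * z j ∂ρ, by ext i j; simp [mul_comm]⟩

/-- `S_n = x₁ + ⋯ + x_n`. -/
def sumVec {d n : ℕ} (x : Fin n → Vec d) : Vec d := ∑ i, x i

/-- `T_n = x₁ ᵗx₁ + ⋯ + x_n ᵗx_n`. -/
def sumOuter {d n : ℕ} (x : Fin n → Vec d) : Matrix (Fin d) (Fin d) ℝ := ∑ i, outer (x i)

theorem sumOuter_isSymm {d n : ℕ} (x : Fin n → Vec d) : (sumOuter x).IsSymm := by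
  unfold sumOuter Matrix.IsSymm
  rw [Matrix.transpose_sum]
  exact Finset.sum_congr rfl fun i _ => outer_isSymm (x i)

/-- The empirical pair `(S_n / n, T_n / n)`. -/
def empiricalPair {d n : ℕ} (x : Fin n → Vec d) : Vec d × SymMatrix d :=
  ((n : ℝ)⁻¹ • sumVec x, ⟨(n : ℝ)⁻¹ • sumOuter x, (sumOuter_isSymm x).smul _⟩)

/-- The law `ν̃_n` of `(S_n / n, T_n / n)` when the `n` vectors are i.i.d. with law `ρ`. -/
def empiricalLaw {d : ℕ} (ρ : Measure (Vec d)) (n : ℕ) : Measure (Vec d × SymMatrix d) :=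
  (Measure.pi fun _ : Fin n => ρ).map empiricalPair

/-- `Δ* = {(x, M) : M` positive definite, `M - x ᵗx` positive semi-definite`}`. -/
def deltaStar (d : ℕ) : Set (Vec d × SymMatrix d) :=
  {p | p.2.1.PosDef ∧ (p.2.1 - outer p.1).PosSemidef}

/-- `D_n⁺`, the set of configurations for which `det T_n > 0`. -/
def nondegenerateSet (d n : ℕ) : Set (Fin n → Vec d) :=
  {x | 0 < (sumOuter x).det}

/-- The weight `exp (⟨T_n⁻¹ S_n, S_n⟩ / 2)` of a configuration. -/
def weight {d n : ℕ} (x : Fin n → Vec d) : ENNReal :=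
  ENNReal.ofReal (Real.exp (invQuad (sumOuter x) (sumVec x) / 2))

/-- The normalization `Z_n`. -/
def partitionFunction {d : ℕ} (ρ : Measure (Vec d)) (n : ℕ) : ENNReal :=
  ∫⁻ x in nondegenerateSet d n, weight x ∂(Measure.pi fun _ : Fin n => ρ)

/-- The law `μ̃_n` of `(X_n¹, …, X_nⁿ)`: density `weight / Z_n` with respect to `ρ^{⊗ n}` on
`D_n⁺`. -/
def modelLaw {d : ℕ} (ρ : Measure (Vec d)) (n : ℕ) : Measure (Fin n → Vec d) :=
  ((Measure.pi fun _ : Fin n => ρ).restrict (nondegenerateSet d n)).withDensity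
    fun x => weight x / partitionFunction ρ n

end CurieWeissSOC

end

noncomputable section

namespace CurieWeissSOC

open Matrix

variable {d n : ℕ}

/-! The core is a local Chernoff bound. The weighted mass is exponentially small near `p₀ = (x, M)`
as soon as some linear functional `tilt u B` has Laplace transform `tiltedMass` below `exp (tilt u B
p₀ - ⟨M⁻¹x, x⟩/2)`. Such a functional exists at every limit point of `Δ*` other than `(0, Σ)`: - `M`
positive definite, `x ≠ 0`: take `u = M⁻¹x`, `B = -u ᵗu/2`. The required bound is then 1, and by
symmetry of `ρ` it follows from `cosh s < exp (s²/2)`. - `M` positive definite, `x = 0`, `M ≠ Σ`: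
take a small multiple of `M - Σ`, as in Cramér's theorem. - `M` singular: penalise a kernel
direction `w`. The Laplace transform tends to `ρ(w^⊥) < e^{-1/2}`, while `⟨M⁻¹x, x⟩ ≤ 1` throughout
`Δ*`.

The exponential moment makes large traces negligible, so compactness (`expSmall_of_isClosed`) yields
(2). For (1), `Z_n ≥ ρ^{⊗n}(D_n⁺)`, which is bounded below for `n ≥ d` because the support of `ρ`
spans. Combining both gives (3). -/

/-! ### Quadratic forms and nondegeneracy. -/

theorem dotProduct_outer_mulVec (w : Fin d → ℝ) (x : Vec d) :
    w ⬝ᵥ outer x *ᵥ w = (w ⬝ᵥ x.ofLp) ^ 2 := by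
  rw [outer, vecMulVec_mulVec, dotProduct_smul, dotProduct_comm x.ofLp w]
  simp [sq]

theorem dotProduct_sumOuter_mulVec (w : Fin d → ℝ) (x : Fin n → Vec d) :
    w ⬝ᵥ sumOuter x *ᵥ w = ∑ i, (w ⬝ᵥ (x i).ofLp) ^ 2 := by
  simp only [sumOuter, sum_mulVec, dotProduct_sum, dotProduct_outer_mulVec]

theorem posSemidef_iff_of_isSymm {M : Matrix (Fin d) (Fin d) ℝ} (hM : M.IsSymm) :
    M.PosSemidef ↔ ∀ w, 0 ≤ w ⬝ᵥ M *ᵥ w := by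
  rw [posSemidef_iff_dotProduct_mulVec]
  simp only [star_trivial, and_iff_right_iff_imp]
  intro _
  rwa [IsHermitian, conjTranspose_eq_transpose_of_trivial]

theorem posDef_iff_of_isSymm {M : Matrix (Fin d) (Fin d) ℝ} (hM : M.IsSymm) :
    M.PosDef ↔ ∀ w, w ≠ 0 → 0 < w ⬝ᵥ M *ᵥ w := by
  rw [posDef_iff_dotProduct_mulVec]
  simp only [star_trivial]
  refine ⟨fun h w => h.2 (x := w), fun h => ⟨?_, fun w => h w⟩⟩
  rwa [IsHermitian, conjTranspose_eq_transpose_of_trivial]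

theorem posSemidef_sumOuter (x : Fin n → Vec d) : (sumOuter x).PosSemidef := by
  rw [posSemidef_iff_of_isSymm (sumOuter_isSymm x)]
  intro w
  rw [dotProduct_sumOuter_mulVec]
  positivity

theorem posDef_iff_det_pos {M : Matrix (Fin d) (Fin d) ℝ} (hM : M.PosSemidef) :
    M.PosDef ↔ 0 < M.det :=
  ⟨fun h => h.det_pos, fun h => hM.posDef_iff_det_ne_zero.2 h.ne'⟩

theorem mem_nondegenerateSet_iff {x : Fin n → Vec d} :
    x ∈ nondegenerateSet d n ↔ ∀ w : Fin d → ℝ, w ≠ 0 → ∃ i, w ⬝ᵥ (x i).ofLp ≠ 0 := by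
  change 0 < (sumOuter x).det ↔ _
  rw [← posDef_iff_det_pos (posSemidef_sumOuter x), posDef_iff_of_isSymm (sumOuter_isSymm x)]
  refine forall₂_congr fun w _ => ?_
  rw [dotProduct_sumOuter_mulVec, Finset.sum_pos_iff_of_nonneg fun i _ => sq_nonneg _]
  simp [sq_pos_iff]

theorem mulVec_inv_mulVec {M : Matrix (Fin d) (Fin d) ℝ} (hM : M.PosDef) (v : Fin d → ℝ) :
    M *ᵥ (M⁻¹ *ᵥ v) = v := by
  rw [mulVec_mulVec, Matrix.mul_nonsing_inv _ ((isUnit_iff_isUnit_det _).1 hM.isUnit), one_mulVec]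

/-- Testing `M - x ᵗx ≥ 0` on `M⁻¹x` gives `q - q² ≥ 0` for `q = ⟨M⁻¹x, x⟩`. -/
theorem invQuad_le_one {p : Vec d × SymMatrix d} (hp : p ∈ deltaStar d) :
    invQuad p.2.1 p.1 ≤ 1 := by
  obtain ⟨h1, h2⟩ := hp
  have h := (posSemidef_iff_of_isSymm (p.2.2.sub (outer_isSymm p.1))).1 h2 (p.2.1⁻¹ *ᵥ p.1.ofLp)
  rw [sub_mulVec, dotProduct_sub, dotProduct_outer_mulVec, mulVec_inv_mulVec h1] at h
  change 0 ≤ invQuad p.2.1 p.1 - invQuad p.2.1 p.1 ^ 2 at h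
  nlinarith

/-! ### Linear functionals, continuity and measurability. -/

/-- The linear functional on pairs used for exponential tilting. -/
def tilt (u : Fin d → ℝ) (B : Matrix (Fin d) (Fin d) ℝ) (x : Vec d)
    (M : Matrix (Fin d) (Fin d) ℝ) : ℝ :=
  u ⬝ᵥ x.ofLp + ∑ i, ∑ j, B i j * M i j

theorem sum_vecMulVec_mul (c : ℝ) (u : Fin d → ℝ) (M : Matrix (Fin d) (Fin d) ℝ) :
    ∑ i, ∑ j, (c • vecMulVec u u) i j * M i j = c * (u ⬝ᵥ M *ᵥ u) := by
  simp only [dotProduct, mulVec, Finset.mul_sum, Matrix.smul_apply, vecMulVec_apply, smul_eq_mul]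
  exact Finset.sum_congr rfl fun i _ => Finset.sum_congr rfl fun j _ => by ring

theorem sum_mul_outer (B : Matrix (Fin d) (Fin d) ℝ) (x : Vec d) :
    ∑ i, ∑ j, B i j * outer x i j = x.ofLp ⬝ᵥ B *ᵥ x.ofLp := by
  simp only [dotProduct, mulVec, Finset.mul_sum, outer, vecMulVec_apply]
  exact Finset.sum_congr rfl fun i _ => Finset.sum_congr rfl fun j _ => by ring

theorem tilt_outer (u : Fin d → ℝ) (B : Matrix (Fin d) (Fin d) ℝ) (x : Vec d) :
    tilt u B x (outer x) = u ⬝ᵥ x.ofLp + x.ofLp ⬝ᵥ B *ᵥ x.ofLp := by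
  rw [tilt, sum_mul_outer]

theorem continuous_symMatrix_apply (i j : Fin d) :
    Continuous fun M : SymMatrix d => M.1 i j :=
  (continuous_apply_apply i j).comp continuous_subtype_val

theorem continuous_tilt (u : Fin d → ℝ) (B : Matrix (Fin d) (Fin d) ℝ) :
    Continuous fun p : Vec d × SymMatrix d => tilt u B p.1 p.2.1 := by
  unfold tilt dotProduct
  refine .add (by fun_prop) (continuous_finsetSum _ fun i _ => continuous_finsetSum _ fun j _ => ?_)
  exact ((continuous_symMatrix_apply i j).comp continuous_snd).const_mul (B i j)

theorem continuous_outer : Continuous (outer : Vec d → Matrix (Fin d) (Fin d) ℝ) := by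
  unfold outer vecMulVec
  exact continuous_matrix fun i j => by simp only [of_apply]; fun_prop

theorem continuous_sumOuter :
    Continuous (sumOuter : (Fin n → Vec d) → Matrix (Fin d) (Fin d) ℝ) :=
  continuous_finsetSum _ fun i _ => continuous_outer.comp (continuous_apply i)

theorem continuous_empiricalPair :
    Continuous (empiricalPair : (Fin n → Vec d) → Vec d × SymMatrix d) := by
  unfold empiricalPair sumVec
  refine Continuous.prodMk (by fun_prop) ?_
  exact Continuous.subtype_mk (continuous_sumOuter.const_smul ((n : ℝ)⁻¹)) _

instance : SecondCountableTopology (SymMatrix d) :=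
  have : SecondCountableTopology (Matrix (Fin d) (Fin d) ℝ) :=
    inferInstanceAs (SecondCountableTopology (Fin d → Fin d → ℝ))
  TopologicalSpace.Subtype.secondCountableTopology _

theorem tilt_empiricalPair (u : Fin d → ℝ) (B : Matrix (Fin d) (Fin d) ℝ) (hn : n ≠ 0)
    (x : Fin n → Vec d) :
    (n : ℝ) * tilt u B (empiricalPair x).1 (empiricalPair x).2.1 =
      ∑ k, tilt u B (x k) (outer (x k)) := by
  have hn' : (n : ℝ) ≠ 0 := by exact_mod_cast hn
  have h1 : (n : ℝ) * (u ⬝ᵥ (empiricalPair x).1.ofLp) = ∑ k, u ⬝ᵥ (x k).ofLp := by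
    simp [empiricalPair, sumVec, dotProduct_sum, hn']
  have h2 (i j : Fin d) : (n : ℝ) * (B i j * (empiricalPair x).2.1 i j) =
      ∑ k, B i j * outer (x k) i j := by
    simp only [empiricalPair, sumOuter, Matrix.smul_apply, Matrix.sum_apply, smul_eq_mul, ← Finset.mul_sum]
    field_simp
  simp only [tilt, mul_add, h1, Finset.mul_sum, h2, Finset.sum_add_distrib]
  congr 1
  rw [Finset.sum_comm]
  simp only [Finset.sum_comm (s := Finset.univ) (t := (Finset.univ : Finset (Fin n)))]
  exact congrArg _ (funext fun k => Finset.sum_comm)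

theorem isClosed_posSemidef : IsClosed {M : SymMatrix d | M.1.PosSemidef} := by
  simp only [posSemidef_iff_of_isSymm (Subtype.prop _), Set.ofPred_forall]
  refine isClosed_iInter fun w => isClosed_le continuous_const ?_
  fun_prop

theorem isClosed_posSemidef_sub_outer :
    IsClosed {p : Vec d × SymMatrix d | (p.2.1 - outer p.1).PosSemidef} := by
  have h (p : Vec d × SymMatrix d) := posSemidef_iff_of_isSymm (p.2.2.sub (outer_isSymm p.1))
  simp only [h, Set.ofPred_forall]
  refine isClosed_iInter fun w => isClosed_le continuous_const ?_
  have := (continuous_outer (d := d)).comp (continuous_fst (Y := SymMatrix d))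
  simp only [Function.comp_def] at this
  fun_prop

theorem measurableSet_deltaStar : MeasurableSet (deltaStar d) := by
  have h : deltaStar d = ({p | p.2.1.PosSemidef} ∩ {p | 0 < p.2.1.det}) ∩
      {p : Vec d × SymMatrix d | (p.2.1 - outer p.1).PosSemidef} := by
    ext p
    simp only [deltaStar, Set.mem_inter_iff, Set.mem_ofPred_eq]
    exact and_congr_left fun _ => ⟨fun h => ⟨h.posSemidef, h.det_pos⟩,
      fun h => (posDef_iff_det_pos h.1).2 h.2⟩
  rw [h]
  refine ((isClosed_posSemidef.preimage continuous_snd).measurableSet.inter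
    (IsOpen.measurableSet ?_)).inter isClosed_posSemidef_sub_outer.measurableSet
  exact isOpen_lt continuous_const (by fun_prop)

/-- The adjugate isolates the only singularity in the factor `det⁻¹`, which gives global
measurability and continuity at positive definite points. -/
theorem invQuad_eq (M : Matrix (Fin d) (Fin d) ℝ) (x : Vec d) :
    invQuad M x = M.det⁻¹ * ((M.adjugate *ᵥ x.ofLp) ⬝ᵥ x.ofLp) := by
  rw [invQuad, inv_def, Ring.inverse_eq_inv', smul_mulVec, smul_dotProduct, smul_eq_mul]

theorem continuous_det : Continuous fun p : Vec d × SymMatrix d => p.2.1.det := by fun_prop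

theorem continuous_adjugate_dotProduct : Continuous fun p : Vec d × SymMatrix d =>
    (p.2.1.adjugate *ᵥ p.1.ofLp) ⬝ᵥ p.1.ofLp := by
  have : Continuous fun p : Vec d × SymMatrix d => p.2.1.adjugate :=
    (continuous_subtype_val.comp continuous_snd).matrix_adjugate
  fun_prop

theorem measurable_invQuad : Measurable fun p : Vec d × SymMatrix d => invQuad p.2.1 p.1 := by
  simp only [invQuad_eq]
  exact continuous_det.measurable.inv.mul continuous_adjugate_dotProduct.measurable

theorem continuousAt_invQuad {p : Vec d × SymMatrix d} (hp : p.2.1.PosDef) :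
    ContinuousAt (fun p : Vec d × SymMatrix d => invQuad p.2.1 p.1) p := by
  simp only [invQuad_eq]
  exact (continuous_det.continuousAt.inv₀ hp.det_pos.ne').mul
    continuous_adjugate_dotProduct.continuousAt

/-! ### Compactness under a trace bound. -/

theorem abs_apply_le_trace {M : Matrix (Fin d) (Fin d) ℝ} (hM : M.PosSemidef) (i j : Fin d) :
    |M i j| ≤ M.trace := by
  have hs : M j i = M i j := by simpa using hM.isHermitian.apply i j
  have h1 : M i i ≤ M.trace := Finset.single_le_sum (f := fun i => M i i)
    (fun k _ => hM.diag_nonneg) (Finset.mem_univ i)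
  have h2 : M j j ≤ M.trace := Finset.single_le_sum (f := fun i => M i i)
    (fun k _ => hM.diag_nonneg) (Finset.mem_univ j)
  have hsymm : M.IsSymm := Matrix.ext fun a b => by simpa using hM.isHermitian.apply a b
  -- Testing on `e_i ± e_j` gives `2|M_ij| ≤ M_ii + M_jj`.
  have key (c : ℝ) : 0 ≤ M i i + c * M i j + c * M j i + c * c * M j j := by
    have h := (posSemidef_iff_of_isSymm hsymm).1 hM
      (Pi.single i 1 + c • Pi.single j 1)
    simp only [mulVec_add, mulVec_smul, add_dotProduct, dotProduct_add, smul_dotProduct,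
      dotProduct_smul, mulVec_single_one, single_one_dotProduct, col_apply, smul_eq_mul] at h
    linarith
  have k1 := key 1
  have k2 := key (-1)
  rw [hs] at k1 k2
  rw [abs_le]
  constructor <;> linarith

theorem norm_sq_le_trace {x : Vec d} {M : Matrix (Fin d) (Fin d) ℝ}
    (h : (M - outer x).PosSemidef) : ‖x‖ ^ 2 ≤ M.trace := by
  have h1 := h.trace_nonneg
  rw [trace_sub, outer, trace_vecMulVec] at h1
  rw [EuclideanSpace.real_norm_sq_eq]
  simp only [dotProduct, ← sq] at h1
  linarith

/-- Semi-definiteness replaces definiteness because `Δ*` is not closed; this is why singular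
matrices must be treated later. -/
theorem isCompact_setOf_trace_le (R : ℝ) : IsCompact {p : Vec d × SymMatrix d |
    p.2.1.PosSemidef ∧ (p.2.1 - outer p.1).PosSemidef ∧ p.2.1.trace ≤ R} := by
  have hc : IsCompact {M : SymMatrix d | ∀ i j, M.1 i j ∈ Set.Icc (-R) R} := by
    have h0 : IsCompact {M : Matrix (Fin d) (Fin d) ℝ | ∀ i j, M i j ∈ Set.Icc (-R) R} := by
      have := isCompact_univ_pi (fun _ : Fin d => isCompact_univ_pi
        (fun _ : Fin d => isCompact_Icc (a := -R) (b := R)))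
      refine this.of_isClosed_subset ?_ fun M hM i _ j _ => hM i j
      simp only [Set.ofPred_forall]
      exact isClosed_iInter fun i => isClosed_iInter fun j =>
        isClosed_Icc.preimage (continuous_apply_apply i j)
    have hcl : IsClosed {M : Matrix (Fin d) (Fin d) ℝ | M.IsSymm} :=
      isClosed_eq (by fun_prop) continuous_id
    exact hcl.isClosedEmbedding_subtypeVal.isCompact_preimage h0
  refine ((isCompact_closedBall (0 : Vec d) (√R)).prod hc).of_isClosed_subset ?_ ?_
  · have h : IsClosed {p : Vec d × SymMatrix d | p.2.1.trace ≤ R} :=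
      isClosed_le (continuous_subtype_val.comp continuous_snd).matrix_trace continuous_const
    exact (isClosed_posSemidef.preimage continuous_snd).inter
      (isClosed_posSemidef_sub_outer.inter h)
  · rintro p ⟨h1, h2, h3⟩
    refine ⟨?_, fun i j => abs_le.1 ((abs_apply_le_trace h1 i j).trans h3)⟩
    rw [mem_closedBall_zero_iff]
    exact Real.le_sqrt_of_sq_le ((norm_sq_le_trace h2).trans h3)

/-! ### The empirical pair and `Δ*`. -/

theorem empiricalPair_mem_deltaStar (hn : n ≠ 0) (x : Fin n → Vec d)
    (hx : x ∈ nondegenerateSet d n) : empiricalPair x ∈ deltaStar d := by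
  have hn' : (0 : ℝ) < n := by exact_mod_cast Nat.pos_of_ne_zero hn
  refine ⟨((posDef_iff_det_pos (posSemidef_sumOuter x)).2 hx).smul (inv_pos.2 hn'), ?_⟩
  rw [posSemidef_iff_of_isSymm ((empiricalPair x).2.2.sub (outer_isSymm _))]
  intro w
  rw [sub_mulVec, dotProduct_sub, dotProduct_outer_mulVec]
  simp only [empiricalPair, smul_mulVec, dotProduct_smul, dotProduct_sumOuter_mulVec, sumVec,
    WithLp.ofLp_smul, WithLp.ofLp_sum, dotProduct_sum, smul_eq_mul]
  -- Cauchy–Schwarz makes the empirical second moment dominate the square of the empirical mean in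
  -- each direction `w`.
  have := sq_sum_le_card_mul_sum_sq (s := Finset.univ) (f := fun i => w ⬝ᵥ (x i).ofLp)
  simp only [Finset.card_univ, Fintype.card_fin] at this
  rw [sub_nonneg, mul_pow]
  calc _ ≤ (n : ℝ)⁻¹ ^ 2 * (n * ∑ i, (w ⬝ᵥ (x i).ofLp) ^ 2) := by gcongr
    _ = _ := by field_simp

theorem invQuad_empiricalPair (hn : n ≠ 0) {x : Fin n → Vec d}
    (hx : x ∈ nondegenerateSet d n) :
    n * invQuad (empiricalPair x).2.1 (empiricalPair x).1 = invQuad (sumOuter x) (sumVec x) := by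
  have hn' : (n : ℝ) ≠ 0 := by exact_mod_cast hn
  have : ((n : ℝ)⁻¹ • sumOuter x)⁻¹ = (n : ℝ) • (sumOuter x)⁻¹ := by
    simpa [Units.smul_def] using inv_smul' (A := sumOuter x) (Units.mk0 (n : ℝ)⁻¹ (inv_ne_zero hn'))
      (isUnit_iff_ne_zero.2 (ne_of_gt hx))
  simp only [invQuad, empiricalPair, this, WithLp.ofLp_smul, smul_mulVec, mulVec_smul,
    smul_dotProduct, dotProduct_smul, smul_eq_mul]
  field_simp

/-! ### Chernoff bounds and local exponential smallness. -/

/-- The Laplace transform of the law of `(z, z ᵗz)`. -/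
def tiltedMass (ρ : Measure (Vec d)) (u : Fin d → ℝ) (B : Matrix (Fin d) (Fin d) ℝ) : ENNReal :=
  ∫⁻ z, ENNReal.ofReal (Real.exp (tilt u B z (outer z))) ∂ρ

/-- The integral of `exp (n ⟨M⁻¹ x, x⟩ / 2)` over `Δ* ∩ S`. -/
def deltaIntegral (ρ : Measure (Vec d)) (n : ℕ) (S : Set (Vec d × SymMatrix d)) : ENNReal :=
  ∫⁻ p in deltaStar d ∩ S, ENNReal.ofReal (Real.exp (n * invQuad p.2.1 p.1 / 2))
    ∂(empiricalLaw ρ n)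

theorem continuous_tilt_outer (u : Fin d → ℝ) (B : Matrix (Fin d) (Fin d) ℝ) :
    Continuous fun z : Vec d => tilt u B z (outer z) := by
  simp only [tilt_outer]
  fun_prop

theorem measurable_exp_tilt (u : Fin d → ℝ) (B : Matrix (Fin d) (Fin d) ℝ) (c : ℝ) :
    Measurable fun p : Vec d × SymMatrix d =>
      ENNReal.ofReal (Real.exp (c * tilt u B p.1 p.2.1)) :=
  (Real.continuous_exp.comp ((continuous_tilt u B).const_mul c)).measurable.ennreal_ofReal

theorem measurable_exp_tilt_outer (u : Fin d → ℝ) (B : Matrix (Fin d) (Fin d) ℝ) :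
    Measurable fun z : Vec d => ENNReal.ofReal (Real.exp (tilt u B z (outer z))) :=
  (Real.continuous_exp.comp (continuous_tilt_outer u B)).measurable.ennreal_ofReal

/-- By linearity, `n` times the tilt of the empirical pair is a sum of i.i.d. terms, so the integral
factorises. -/
theorem lintegral_exp_tilt (ρ : Measure (Vec d)) [IsProbabilityMeasure ρ] (u : Fin d → ℝ)
    (B : Matrix (Fin d) (Fin d) ℝ) (hn : n ≠ 0) :
    ∫⁻ p, ENNReal.ofReal (Real.exp (n * tilt u B p.1 p.2.1)) ∂(empiricalLaw ρ n) =
      tiltedMass ρ u B ^ n := by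
  rw [empiricalLaw, lintegral_map (measurable_exp_tilt u B n) continuous_empiricalPair.measurable]
  simp only [tilt_empiricalPair u B hn, Real.exp_sum]
  simp only [ENNReal.ofReal_prod_of_nonneg fun _ _ => (Real.exp_pos _).le]
  have hm := measurable_exp_tilt_outer u B
  rw [ProbabilityTheory.lintegral_prod_eq_prod_lintegral_of_indepFun Finset.univ
    (fun k (x : Fin n → Vec d) => ENNReal.ofReal (Real.exp (tilt u B (x k) (outer (x k)))))
    (ProbabilityTheory.iIndepFun_pi (μ := fun _ : Fin n => ρ) fun _ => hm.aemeasurable)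
    fun k => hm.comp (measurable_pi_apply k)]
  have h (k : Fin n) : ∫⁻ x, ENNReal.ofReal (Real.exp (tilt u B (x k) (outer (x k))))
      ∂(Measure.pi fun _ : Fin n => ρ) = tiltedMass ρ u B :=
    (measurePreserving_eval (fun _ : Fin n => ρ) k).lintegral_comp hm
  simp [h]

theorem deltaIntegral_le {ρ : Measure (Vec d)} [IsProbabilityMeasure ρ] {u : Fin d → ℝ}
    {B : Matrix (Fin d) (Fin d) ℝ} {S : Set (Vec d × SymMatrix d)} {b : ℝ} (hn : n ≠ 0)
    (h : ∀ p ∈ deltaStar d, p ∈ S → invQuad p.2.1 p.1 / 2 ≤ tilt u B p.1 p.2.1 - b) :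
    deltaIntegral ρ n S ≤ ENNReal.ofReal (Real.exp (-(n * b))) * tiltedMass ρ u B ^ n := by
  have hc := measurable_exp_tilt u B n
  calc deltaIntegral ρ n S
    _ ≤ ∫⁻ p in deltaStar d ∩ S, ENNReal.ofReal (Real.exp (-(n * b))) *
          ENNReal.ofReal (Real.exp (n * tilt u B p.1 p.2.1)) ∂(empiricalLaw ρ n) := by
        refine setLIntegral_mono (hc.const_mul _) fun p hp => ?_
        rw [← ENNReal.ofReal_mul (Real.exp_pos _).le, ← Real.exp_add]
        gcongr
        have := mul_le_mul_of_nonneg_left (h p hp.1 hp.2) (Nat.cast_nonneg (α := ℝ) n)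
        linarith
    _ ≤ ∫⁻ p, ENNReal.ofReal (Real.exp (-(n * b))) *
          ENNReal.ofReal (Real.exp (n * tilt u B p.1 p.2.1)) ∂(empiricalLaw ρ n) :=
        setLIntegral_le_lintegral _ _
    _ = _ := by rw [lintegral_const_mul _ hc, lintegral_exp_tilt ρ u B hn]

/-- The weighted mass of `Δ* ∩ S` decays exponentially fast. -/
def ExpSmall (ρ : Measure (Vec d)) (S : Set (Vec d × SymMatrix d)) : Prop :=
  ∃ δ : ℝ, 0 < δ ∧ ∃ C : NNReal, ∀ n : ℕ, n ≠ 0 →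
    deltaIntegral ρ n S ≤ C * ENNReal.ofReal (Real.exp (-(n * δ)))

theorem ExpSmall.mono {ρ : Measure (Vec d)} {S T : Set (Vec d × SymMatrix d)} (hST : S ⊆ T)
    (h : ExpSmall ρ T) : ExpSmall ρ S := by
  obtain ⟨δ, hδ, C, hC⟩ := h
  exact ⟨δ, hδ, C, fun n hn => (lintegral_mono_set (by gcongr)).trans (hC n hn)⟩

theorem expSmall_empty (ρ : Measure (Vec d)) : ExpSmall ρ ∅ :=
  ⟨1, one_pos, 0, fun n _ => by simp [deltaIntegral]⟩

/-- Together with `ExpSmall.mono` and `expSmall_empty`, this permits induction over compact sets;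
the constant `C` in `ExpSmall` absorbs the sum. -/
theorem ExpSmall.union {ρ : Measure (Vec d)} {S T : Set (Vec d × SymMatrix d)}
    (hS : ExpSmall ρ S) (hT : ExpSmall ρ T) : ExpSmall ρ (S ∪ T) := by
  obtain ⟨δ, hδ, C, hC⟩ := hS
  obtain ⟨δ', hδ', C', hC'⟩ := hT
  refine ⟨min δ δ', lt_min hδ hδ', C + C', fun n hn => ?_⟩
  rw [deltaIntegral, Set.inter_union_distrib_left]
  refine (lintegral_union_le _ _ _).trans ((add_le_add (hC n hn) (hC' n hn)).trans ?_)
  rw [ENNReal.coe_add, add_mul]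
  gcongr
  · exact min_le_left _ _
  · exact min_le_right _ _

theorem expSmall_of_tiltedMass_le {ρ : Measure (Vec d)} [IsProbabilityMeasure ρ]
    {u : Fin d → ℝ} {B : Matrix (Fin d) (Fin d) ℝ} {S : Set (Vec d × SymMatrix d)} {a δ : ℝ}
    (hδ : 0 < δ) (ha : tiltedMass ρ u B ≤ ENNReal.ofReal (Real.exp a))
    (h : ∀ p ∈ deltaStar d, p ∈ S → invQuad p.2.1 p.1 / 2 ≤ tilt u B p.1 p.2.1 - (a + δ)) :
    ExpSmall ρ S := by
  refine ⟨δ, hδ, 1, fun n hn => (deltaIntegral_le hn h).trans ?_⟩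
  calc _ ≤ ENNReal.ofReal (Real.exp (-(n * (a + δ)))) * ENNReal.ofReal (Real.exp a) ^ n := by
        gcongr
    _ = _ := by
        rw [← ENNReal.ofReal_pow (Real.exp_pos _).le, ← ENNReal.ofReal_mul (Real.exp_pos _).le,
          ← Real.exp_nat_mul, ← Real.exp_add, ENNReal.coe_one, one_mul]
        congr 2
        ring

theorem exists_expSmall_nhds {ρ : Measure (Vec d)} [IsProbabilityMeasure ρ]
    {u : Fin d → ℝ} {B : Matrix (Fin d) (Fin d) ℝ} {p₀ : Vec d × SymMatrix d} {a : ℝ}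
    (ha : tiltedMass ρ u B < ENNReal.ofReal (Real.exp a))
    (h : ∀ η : ℝ, 0 < η → ∀ᶠ p in 𝓝 p₀, p ∈ deltaStar d →
      invQuad p.2.1 p.1 / 2 ≤ tilt u B p.1 p.2.1 - a + η) :
    ∃ V ∈ 𝓝 p₀, ExpSmall ρ V := by
  obtain ⟨r, hr, hra⟩ := ENNReal.lt_iff_exists_nnreal_btwn.1 ha
  have hr0 : (0 : ℝ) < r := by exact_mod_cast (zero_le.trans_lt hr)
  have hlog : Real.log r < a := by
    rw [Real.log_lt_iff_lt_exp hr0]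
    rw [← ENNReal.ofReal_coe_nnreal] at hra
    exact (ENNReal.ofReal_lt_ofReal_iff (Real.exp_pos _)).1 hra
  -- Half of the gap `a - log r` pays for the variation over the neighbourhood; the other half is
  -- the decay rate.
  refine ⟨_, h ((a - Real.log r) / 2) (by linarith), ?_⟩
  refine expSmall_of_tiltedMass_le (u := u) (B := B) (a := Real.log r)
    (δ := (a - Real.log r) / 2) (by linarith) ?_ fun p hp hpS => ?_
  · rw [Real.exp_log hr0, ENNReal.ofReal_coe_nnreal]
    exact hr.le
  · have := hpS hp
    linarith

theorem eventually_tilt {p₀ : Vec d × SymMatrix d} (u : Fin d → ℝ)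
    (B : Matrix (Fin d) (Fin d) ℝ) {a η : ℝ} (hη : 0 < η) (ha : a ≤ tilt u B p₀.1 p₀.2.1) :
    ∀ᶠ p in 𝓝 p₀, a ≤ tilt u B p.1 p.2.1 + η := by
  filter_upwards [(continuous_tilt u B).continuousAt.eventually
    (lt_mem_nhds (show tilt u B p₀.1 p₀.2.1 - η < _ by linarith))] with p hp
  linarith

/-- At a point with positive definite matrix, tilting by more than the exponent suffices. -/
theorem exists_expSmall_nhds_of_posDef {ρ : Measure (Vec d)} [IsProbabilityMeasure ρ]
    {u : Fin d → ℝ} {B : Matrix (Fin d) (Fin d) ℝ} {p₀ : Vec d × SymMatrix d}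
    (hp₀ : p₀.2.1.PosDef)
    (h : tiltedMass ρ u B <
      ENNReal.ofReal (Real.exp (tilt u B p₀.1 p₀.2.1 - invQuad p₀.2.1 p₀.1 / 2))) :
    ∃ V ∈ 𝓝 p₀, ExpSmall ρ V := by
  refine exists_expSmall_nhds h fun η hη => ?_
  filter_upwards [eventually_tilt u B (half_pos hη) le_rfl,
    (continuousAt_invQuad hp₀).eventually (gt_mem_nhds (show _ < invQuad p₀.2.1 p₀.1 + η by
      linarith))] with p h1 h2 _
  linarith

/-- At an arbitrary point, the bound `⟨M⁻¹ x, x⟩ ≤ 1` is used for the exponent. -/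
theorem exists_expSmall_nhds_of_half {ρ : Measure (Vec d)} [IsProbabilityMeasure ρ]
    {u : Fin d → ℝ} {B : Matrix (Fin d) (Fin d) ℝ} {p₀ : Vec d × SymMatrix d}
    (h : tiltedMass ρ u B < ENNReal.ofReal (Real.exp (tilt u B p₀.1 p₀.2.1 - 1 / 2))) :
    ∃ V ∈ 𝓝 p₀, ExpSmall ρ V := by
  refine exists_expSmall_nhds h fun η hη => ?_
  filter_upwards [eventually_tilt u B hη le_rfl] with p h1 hp
  have := invQuad_le_one hp
  linarith

/-! ### Points with nonzero mean. -/

/-- With `y = exp (s²/4)`, the weak inequality at `s/2` gives `cosh s ≤ 2y - 1`, and `2y - 1 < y²`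
since `y ≠ 1`. -/
theorem cosh_lt_exp_half_sq {s : ℝ} (hs : s ≠ 0) : Real.cosh s < Real.exp (s ^ 2 / 2) := by
  have h1 := Real.cosh_le_exp_half_sq (s / 2)
  have h2 : Real.cosh s = 2 * Real.cosh (s / 2) ^ 2 - 1 := by
    have h3 := Real.cosh_two_mul (s / 2)
    rw [mul_div_cancel₀ s two_ne_zero, Real.sinh_sq] at h3
    linarith
  have h4 : Real.cosh (s / 2) ^ 2 ≤ Real.exp (s ^ 2 / 4) := by
    calc Real.cosh (s / 2) ^ 2 ≤ Real.exp ((s / 2) ^ 2 / 2) ^ 2 := by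
          gcongr
      _ = _ := by rw [← Real.exp_nat_mul]; congr 1; push_cast; ring
  have h5 : Real.exp (s ^ 2 / 2) = Real.exp (s ^ 2 / 4) ^ 2 := by
    rw [← Real.exp_nat_mul]; congr 1; push_cast; ring
  have h6 : 1 < Real.exp (s ^ 2 / 4) := Real.one_lt_exp_iff.2 (by positivity)
  rw [h2, h5]
  nlinarith [sq_pos_of_pos (sub_pos.2 h6)]

theorem abs_apply_le_norm (z : Vec d) (i : Fin d) : |z i| ≤ ‖z‖ := by
  simpa using PiLp.norm_apply_le z i

theorem abs_outer_apply_le (z : Vec d) (i j : Fin d) : |outer z i j| ≤ ‖z‖ ^ 2 := by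
  rw [outer, vecMulVec_apply, abs_mul, sq]
  exact mul_le_mul (abs_apply_le_norm z i) (abs_apply_le_norm z j) (abs_nonneg _) (norm_nonneg _)

theorem continuous_outer_apply (i j : Fin d) : Continuous fun z : Vec d => outer z i j :=
  (continuous_apply_apply i j).comp continuous_outer

theorem integrable_outer_apply {ρ : Measure (Vec d)} (hmom : Integrable (fun z => ‖z‖ ^ 2) ρ)
    (i j : Fin d) : Integrable (fun z => outer z i j) ρ :=
  hmom.mono' (continuous_outer_apply i j).aestronglyMeasurable
    (Eventually.of_forall fun z => abs_outer_apply_le z i j)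

theorem integral_sum_mul_outer {ρ : Measure (Vec d)} (hmom : Integrable (fun z => ‖z‖ ^ 2) ρ)
    (B : Matrix (Fin d) (Fin d) ℝ) :
    ∫ z, ∑ i, ∑ j, B i j * outer z i j ∂ρ = ∑ i, ∑ j, B i j * (covMatrix ρ).1 i j := by
  have h (i j : Fin d) := (integrable_outer_apply hmom i j).const_mul (B i j)
  rw [integral_finsetSum _ fun i _ => integrable_finsetSum _ fun j _ => h i j]
  refine Finset.sum_congr rfl fun i _ => ?_
  rw [integral_finsetSum _ fun j _ => h i j]
  refine Finset.sum_congr rfl fun j _ => ?_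
  rw [integral_const_mul]
  rfl

theorem measure_dotProduct_ne_zero {ρ : Measure (Vec d)}
    (hmom : Integrable (fun z => ‖z‖ ^ 2) ρ) (hcov : (covMatrix ρ).1.PosDef) {u : Fin d → ℝ}
    (hu : u ≠ 0) : ρ {z | u ⬝ᵥ z.ofLp ≠ 0} ≠ 0 := by
  intro h
  have hae : ∀ᵐ z ∂ρ, u ⬝ᵥ z.ofLp = 0 := h
  have h1 := integral_sum_mul_outer hmom ((1 : ℝ) • vecMulVec u u)
  simp only [sum_vecMulVec_mul, one_mul, dotProduct_outer_mulVec] at h1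
  have h2 := (posDef_iff_of_isSymm (covMatrix ρ).2).1 hcov u hu
  rw [← h1, integral_congr_ae (g := fun _ => (0 : ℝ)) (hae.mono fun z hz => by simp [hz])] at h2
  simp at h2

theorem tilt_half_sq (u : Fin d → ℝ) (x : Vec d) (M : Matrix (Fin d) (Fin d) ℝ) :
    tilt u ((-(1 / 2) : ℝ) • vecMulVec u u) x M = u ⬝ᵥ x.ofLp - (u ⬝ᵥ M *ᵥ u) / 2 := by
  rw [tilt, sum_vecMulVec_mul]
  ring

/-- Averaging over `z` and `-z` turns the integrand into `cosh s * exp (-s²/2)` with `s = ⟨u, z⟩`.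
It is at most 1, strictly less where `s ≠ 0`, an event of positive measure since `Σ` is definite. -/
theorem tiltedMass_half_sq_lt_one {ρ : Measure (Vec d)} [IsProbabilityMeasure ρ]
    (hsymm : ρ.map (fun z => -z) = ρ) (hmom : Integrable (fun z => ‖z‖ ^ 2) ρ)
    (hcov : (covMatrix ρ).1.PosDef) {u : Fin d → ℝ} (hu : u ≠ 0) :
    tiltedMass ρ u ((-(1 / 2) : ℝ) • vecMulVec u u) < 1 := by
  set B : Matrix (Fin d) (Fin d) ℝ := (-(1 / 2) : ℝ) • vecMulVec u u with hB
  have hm := measurable_exp_tilt_outer u B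
  have hneg : tiltedMass ρ u B =
      ∫⁻ z, ENNReal.ofReal (Real.exp (tilt u B (-z) (outer (-z)))) ∂ρ := by
    conv_lhs => rw [tiltedMass, ← hsymm]
    exact lintegral_map hm measurable_neg
  have hadd (z : Vec d) : ENNReal.ofReal (Real.exp (tilt u B z (outer z))) +
      ENNReal.ofReal (Real.exp (tilt u B (-z) (outer (-z)))) =
      ENNReal.ofReal (2 * (Real.cosh (u ⬝ᵥ z.ofLp) / Real.exp ((u ⬝ᵥ z.ofLp) ^ 2 / 2))) := by
    rw [← ENNReal.ofReal_add (Real.exp_pos _).le (Real.exp_pos _).le, hB, tilt_half_sq,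
      tilt_half_sq, dotProduct_outer_mulVec, dotProduct_outer_mulVec, WithLp.ofLp_neg,
      dotProduct_neg, neg_sq, sub_eq_add_neg, sub_eq_add_neg, Real.exp_add, Real.exp_add,
      Real.cosh_eq, Real.exp_neg (_ / 2)]
    congr 1
    ring
  have hlt : 2 * tiltedMass ρ u B < 2 := by
    calc 2 * tiltedMass ρ u B
      _ = ∫⁻ z, ENNReal.ofReal
            (2 * (Real.cosh (u ⬝ᵥ z.ofLp) / Real.exp ((u ⬝ᵥ z.ofLp) ^ 2 / 2))) ∂ρ := by
          rw [two_mul]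
          nth_rw 2 [hneg]
          rw [tiltedMass, ← lintegral_add_left hm]
          exact lintegral_congr hadd
      _ < ∫⁻ _, 2 ∂ρ := by
          have hle (z : Vec d) : ENNReal.ofReal
              (2 * (Real.cosh (u ⬝ᵥ z.ofLp) / Real.exp ((u ⬝ᵥ z.ofLp) ^ 2 / 2))) ≤ 2 := by
            refine ENNReal.ofReal_le_of_le_toReal ?_
            have := (div_le_one (Real.exp_pos _)).2 (Real.cosh_le_exp_half_sq (u ⬝ᵥ z.ofLp))
            simpa using this
          refine lintegral_strict_mono_of_ae_le_of_ae_lt_on aemeasurable_const ?_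
            (Eventually.of_forall hle) (measure_dotProduct_ne_zero hmom hcov hu) ?_
          · exact ((lintegral_mono hle).trans_lt (by simp)).ne
          · refine Eventually.of_forall fun z hz => ?_
            have := (div_lt_one (Real.exp_pos _)).2 (cosh_lt_exp_half_sq hz)
            refine ((ENNReal.ofReal_lt_ofReal_iff (two_pos (α := ℝ))).2 ?_).trans_eq (by simp)
            linarith
      _ = 2 := by simp
  by_contra! hge
  exact absurd hlt (not_lt.2 (by simpa using mul_le_mul_right hge 2))

theorem exists_expSmall_nhds_of_ne_zero {ρ : Measure (Vec d)} [IsProbabilityMeasure ρ]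
    (hsymm : ρ.map (fun z => -z) = ρ) (hmom : Integrable (fun z => ‖z‖ ^ 2) ρ)
    (hcov : (covMatrix ρ).1.PosDef) {p₀ : Vec d × SymMatrix d} (hp : p₀.2.1.PosDef)
    (hx : p₀.1 ≠ 0) : ∃ V ∈ 𝓝 p₀, ExpSmall ρ V := by
  have hM := mulVec_inv_mulVec hp p₀.1.ofLp
  have hu : p₀.2.1⁻¹ *ᵥ p₀.1.ofLp ≠ 0 := by
    intro h
    rw [h, mulVec_zero] at hM
    exact hx (WithLp.ofLp_injective 2 hM.symm)
  refine exists_expSmall_nhds_of_posDef hp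
    ((tiltedMass_half_sq_lt_one hsymm hmom hcov hu).trans_eq ?_)
  rw [tilt_half_sq, hM, invQuad]
  ring_nf
  simp

/-! ### Points with zero mean and wrong covariance. -/

theorem sum_smul_mul (t : ℝ) (B M : Matrix (Fin d) (Fin d) ℝ) :
    ∑ i, ∑ j, (t • B) i j * M i j = t * ∑ i, ∑ j, B i j * M i j := by
  simp only [Finset.mul_sum, Matrix.smul_apply, smul_eq_mul, mul_assoc]

theorem abs_sum_mul_outer_le (B : Matrix (Fin d) (Fin d) ℝ) (z : Vec d) :
    |∑ i, ∑ j, B i j * outer z i j| ≤ (∑ i, ∑ j, |B i j|) * ‖z‖ ^ 2 := by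
  simp only [Finset.sum_mul]
  refine (Finset.abs_sum_le_sum_abs _ _).trans (Finset.sum_le_sum fun i _ => ?_)
  refine (Finset.abs_sum_le_sum_abs _ _).trans (Finset.sum_le_sum fun j _ => ?_)
  rw [abs_mul]
  exact mul_le_mul_of_nonneg_left (abs_outer_apply_le z i j) (abs_nonneg _)

/-- Both sides equal 1 at `t = 0`, and right minus left has derivative `⟨B, M⟩ - ⟨B, Σ⟩ > 0` there.
-/
theorem exists_tiltedMass_lt {ρ : Measure (Vec d)} [IsProbabilityMeasure ρ]
    (hmom : Integrable (fun z => ‖z‖ ^ 2) ρ) {v₀ : ℝ} (hv₀ : 0 < v₀)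
    (hexp : Integrable (fun z => Real.exp (v₀ * ‖z‖ ^ 2)) ρ) {B M : Matrix (Fin d) (Fin d) ℝ}
    (h : ∑ i, ∑ j, B i j * (covMatrix ρ).1 i j < ∑ i, ∑ j, B i j * M i j) :
    ∃ t : ℝ, tiltedMass ρ 0 (t • B) < ENNReal.ofReal (Real.exp (t * ∑ i, ∑ j, B i j * M i j)) := by
  set X : Vec d → ℝ := fun z => ∑ i, ∑ j, B i j * outer z i j with hX
  set m := ∑ i, ∑ j, B i j * M i j with hm
  have hXc : Continuous X := continuous_finsetSum _ fun i _ => continuous_finsetSum _ fun j _ =>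
    (continuous_outer_apply i j).const_mul _
  set c := ∑ i, ∑ j, |B i j| with hc
  have hc0 : 0 ≤ c := Finset.sum_nonneg fun i _ => Finset.sum_nonneg fun j _ => abs_nonneg _
  -- Since `|X z| ≤ c‖z‖²`, the exponential moment dominates; `c + 1` avoids dividing by zero.
  have hint (t : ℝ) (ht : |t| < v₀ / (c + 1)) : Integrable (fun z => Real.exp (t * X z)) ρ := by
    refine hexp.mono' (by fun_prop) (Eventually.of_forall fun z => ?_)
    rw [Real.norm_eq_abs, Real.abs_exp]
    rw [Real.exp_le_exp]
    rw [lt_div_iff₀ (by positivity)] at ht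
    calc t * X z ≤ |t| * |X z| := by rw [← abs_mul]; exact le_abs_self _
      _ ≤ |t| * (c * ‖z‖ ^ 2) := by gcongr; exact abs_sum_mul_outer_le B z
      _ = (|t| * c) * ‖z‖ ^ 2 := by ring
      _ ≤ v₀ * ‖z‖ ^ 2 := by
        gcongr
        nlinarith [abs_nonneg t]
  have hr : 0 < v₀ / (c + 1) := by positivity
  have hball : Metric.ball (0 : ℝ) (v₀ / (c + 1)) ⊆ ProbabilityTheory.integrableExpSet X ρ :=
    fun t ht => hint t (by simpa using ht)
  have hmem : (0 : ℝ) ∈ interior (ProbabilityTheory.integrableExpSet X ρ) :=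
    mem_interior.2 ⟨_, hball, Metric.isOpen_ball, Metric.mem_ball_self hr⟩
  have hder : HasDerivAt (fun t => Real.exp (t * m) - ProbabilityTheory.mgf X ρ t)
      (m - ∫ z, X z ∂ρ) 0 := by
    have h1 := ProbabilityTheory.hasDerivAt_mgf hmem
    have h2 := ((hasDerivAt_id (0 : ℝ)).mul_const m).exp
    simpa using! h2.sub h1
  rw [integral_sum_mul_outer hmom B] at hder
  have hpos := (hasDerivAt_iff_tendsto_slope_zero.1 hder).eventually
    (lt_mem_nhds (sub_pos.2 h))
  -- `t > 0` converts the positive slope into the inequality; `t` in the ball keeps the moment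
  -- generating function finite.
  have hpos' := Eventually.and
    (hpos.filter_mono (nhdsWithin_mono 0 fun t (ht : t ∈ Set.Ioi (0 : ℝ)) => ne_of_gt ht))
    (inter_mem (self_mem_nhdsWithin (a := (0 : ℝ)) (s := Set.Ioi 0))
      (mem_nhdsWithin_of_mem_nhds (Metric.ball_mem_nhds 0 hr)))
  obtain ⟨t, ht, ht0 : 0 < t, htb⟩ := hpos'.exists
  refine ⟨t, ?_⟩
  have htm : tiltedMass ρ 0 (t • B) = ENNReal.ofReal (ProbabilityTheory.mgf X ρ t) := by
    rw [ProbabilityTheory.mgf, ofReal_integral_eq_lintegral_ofReal (hint t (by simpa using htb))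
      (Eventually.of_forall fun z => (Real.exp_pos _).le), tiltedMass]
    refine lintegral_congr fun z => ?_
    rw [tilt, zero_dotProduct, zero_add, sum_smul_mul]
  rw [htm, ENNReal.ofReal_lt_ofReal_iff (Real.exp_pos _)]
  simp only [zero_add, zero_mul, Real.exp_zero, ProbabilityTheory.mgf_zero, sub_self, sub_zero,
    smul_eq_mul] at ht
  have := (mul_pos_iff_of_pos_left (inv_pos.2 ht0)).1 ht
  linarith

theorem exists_expSmall_nhds_of_ne_covMatrix {ρ : Measure (Vec d)} [IsProbabilityMeasure ρ]
    (hmom : Integrable (fun z => ‖z‖ ^ 2) ρ) {v₀ : ℝ} (hv₀ : 0 < v₀)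
    (hexp : Integrable (fun z => Real.exp (v₀ * ‖z‖ ^ 2)) ρ)
    {p₀ : Vec d × SymMatrix d} (hp : p₀.2.1.PosDef) (hx : p₀.1 = 0) (hM : p₀.2 ≠ covMatrix ρ) :
    ∃ V ∈ 𝓝 p₀, ExpSmall ρ V := by
  -- For `B = M - Σ`, the two pairings differ by the squared Frobenius norm of `M - Σ`.
  have hpos : ∑ i, ∑ j, (p₀.2.1 - (covMatrix ρ).1) i j * (covMatrix ρ).1 i j <
      ∑ i, ∑ j, (p₀.2.1 - (covMatrix ρ).1) i j * p₀.2.1 i j := by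
    rw [← sub_pos]
    simp only [← Finset.sum_sub_distrib, ← mul_sub, ← Matrix.sub_apply]
    by_contra! hle
    refine hM (Subtype.ext (sub_eq_zero.1 (Matrix.ext fun i j => ?_)))
    have h0 := le_antisymm hle (Finset.sum_nonneg fun i _ => Finset.sum_nonneg fun j _ =>
      mul_self_nonneg _)
    have h1 := (Finset.sum_eq_zero_iff_of_nonneg fun i _ => Finset.sum_nonneg fun j _ =>
      mul_self_nonneg _).1 h0 i (Finset.mem_univ i)
    exact mul_self_eq_zero.1 ((Finset.sum_eq_zero_iff_of_nonneg fun j _ =>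
      mul_self_nonneg _).1 h1 j (Finset.mem_univ j))
  obtain ⟨t, ht⟩ := exists_tiltedMass_lt hmom hv₀ hexp hpos
  refine exists_expSmall_nhds_of_posDef hp (ht.trans_eq ?_)
  rw [tilt, sum_smul_mul, invQuad, hx]
  simp

/-! ### Points with singular matrix. -/

theorem tendsto_tiltedMass_neg (ρ : Measure (Vec d)) [IsProbabilityMeasure ρ] (w : Fin d → ℝ) :
    Tendsto (fun k : ℕ => tiltedMass ρ 0 ((-(k : ℝ)) • vecMulVec w w)) atTop
      (𝓝 (ρ {z | w ⬝ᵥ z.ofLp = 0})) := by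
  have hms : MeasurableSet {z : Vec d | w ⬝ᵥ z.ofLp = 0} :=
    (isClosed_eq (by fun_prop) continuous_const).measurableSet
  rw [← lintegral_indicator_one hms]
  have h (k : ℕ) (z : Vec d) : tilt 0 ((-(k : ℝ)) • vecMulVec w w) z (outer z) =
      -(k * (w ⬝ᵥ z.ofLp) ^ 2) := by
    rw [tilt, sum_vecMulVec_mul, dotProduct_outer_mulVec, zero_dotProduct]
    ring
  refine tendsto_lintegral_of_dominated_convergence (fun _ => 1)
    (fun k => measurable_exp_tilt_outer _ _) (fun k => Eventually.of_forall fun z => ?_)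
    (by simp) (Eventually.of_forall fun z => ?_)
  · simp only [h]
    simp only [ENNReal.ofReal_le_one, Real.exp_le_one_iff]
    exact neg_nonpos.2 (by positivity)
  · simp only [h]
    by_cases hz : w ⬝ᵥ z.ofLp = 0
    · rw [Set.indicator_of_mem (by exact hz)]
      simp [hz]
    · rw [Set.indicator_of_notMem (by exact hz), ← ENNReal.ofReal_zero]
      refine ENNReal.tendsto_ofReal (Real.tendsto_exp_neg_atTop_nhds_zero.comp ?_)
      exact tendsto_natCast_atTop_atTop.atTop_mul_const (by positivity)

theorem exists_submodule_eq (w : Fin d → ℝ) (hw : w ≠ 0) : ∃ H : Submodule ℝ (Vec d),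
    Module.finrank ℝ H + 1 = d ∧ (H : Set (Vec d)) = {z | w ⬝ᵥ z.ofLp = 0} := by
  have hw' : WithLp.toLp 2 w ≠ 0 := fun h => hw (congrArg WithLp.ofLp h)
  refine ⟨(ℝ ∙ (WithLp.toLp 2 w))ᗮ, ?_, ?_⟩
  · have h1 := (ℝ ∙ (WithLp.toLp 2 w)).finrank_add_finrank_orthogonal
    rw [finrank_span_singleton hw', finrank_euclideanSpace_fin] at h1
    rw [add_comm, h1]
  · ext z
    rw [SetLike.mem_coe, Submodule.mem_orthogonal_singleton_iff_inner_right]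
    simp [EuclideanSpace.inner_eq_star_dotProduct, dotProduct_comm]

/-- The penalty `-k w ᵗw` costs nothing at `p₀`, where `ᵗw M w = 0`. The threshold `1/√e` is exactly
what the exponent bound `1/2` requires. -/
theorem exists_expSmall_nhds_of_not_posDef {ρ : Measure (Vec d)} [IsProbabilityMeasure ρ]
    (hH : ∀ H : Submodule ℝ (Vec d), Module.finrank ℝ H + 1 = d →
      ρ (H : Set (Vec d)) < ENNReal.ofReal (1 / √(Real.exp 1)))
    {p₀ : Vec d × SymMatrix d} (hp : ¬ p₀.2.1.PosDef) (hp' : p₀.2.1.PosSemidef) :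
    ∃ V ∈ 𝓝 p₀, ExpSmall ρ V := by
  rw [posDef_iff_of_isSymm p₀.2.2] at hp
  push Not at hp
  obtain ⟨w, hw, hle⟩ := hp
  have h0 := le_antisymm hle ((posSemidef_iff_of_isSymm p₀.2.2).1 hp' w)
  obtain ⟨H, hHd, hHw⟩ := exists_submodule_eq w hw
  have hlt := hH H hHd
  rw [hHw] at hlt
  obtain ⟨k, hk⟩ := ((tendsto_tiltedMass_neg ρ w).eventually (gt_mem_nhds hlt)).exists
  refine exists_expSmall_nhds_of_half (hk.trans_eq ?_)
  rw [tilt, sum_vecMulVec_mul, h0, zero_dotProduct, mul_zero, add_zero, zero_sub, Real.exp_neg,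
    one_div, Real.exp_half]

/-! ### Large traces and the global upper bound. -/

theorem exists_expSmall_trace {ρ : Measure (Vec d)} [IsProbabilityMeasure ρ]
    {v₀ : ℝ} (hv₀ : 0 < v₀) (hexp : Integrable (fun z => Real.exp (v₀ * ‖z‖ ^ 2)) ρ) :
    ∃ R : ℝ, ExpSmall ρ {p | R < p.2.1.trace} := by
  set a := Real.log (∫ z, Real.exp (v₀ * ‖z‖ ^ 2) ∂ρ) with ha
  have htilt (x : Vec d) (M : Matrix (Fin d) (Fin d) ℝ) :
      tilt 0 (v₀ • 1) x M = v₀ * M.trace := by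
    rw [tilt, sum_smul_mul, zero_dotProduct, zero_add]
    simp [Matrix.one_apply, trace]
  -- The `3/2` is the rate `δ = 1` plus the bound `1/2` on the exponent.
  refine ⟨(a + 3 / 2) / v₀, expSmall_of_tiltedMass_le (u := 0) (B := v₀ • 1) (a := a) (δ := 1)
    one_pos ?_ fun p hp hpS => ?_⟩
  · rw [ha, Real.exp_log (integral_exp_pos hexp), ofReal_integral_eq_lintegral_ofReal hexp
      (Eventually.of_forall fun z => (Real.exp_pos _).le), tiltedMass]
    refine le_of_eq (lintegral_congr fun z => ?_)
    rw [htilt, outer, trace_vecMulVec, EuclideanSpace.real_norm_sq_eq]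
    simp [dotProduct, sq]
  · have h1 := invQuad_le_one hp
    have h2 : (a + 3 / 2) / v₀ < p.2.1.trace := hpS
    rw [div_lt_iff₀ hv₀] at h2
    rw [htilt]
    linarith

theorem expSmall_of_isClosed {ρ : Measure (Vec d)} [IsProbabilityMeasure ρ]
    (hsymm : ρ.map (fun z => -z) = ρ) (hmom : Integrable (fun z => ‖z‖ ^ 2) ρ)
    (hcov : (covMatrix ρ).1.PosDef) {v₀ : ℝ} (hv₀ : 0 < v₀)
    (hexp : Integrable (fun z => Real.exp (v₀ * ‖z‖ ^ 2)) ρ)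
    (hH : ∀ H : Submodule ℝ (Vec d), Module.finrank ℝ H + 1 = d →
      ρ (H : Set (Vec d)) < ENNReal.ofReal (1 / √(Real.exp 1)))
    {A : Set (Vec d × SymMatrix d)} (hA : IsClosed A) (h0 : ((0 : Vec d), covMatrix ρ) ∉ A) :
    ExpSmall ρ A := by
  obtain ⟨R, hR⟩ := exists_expSmall_trace hv₀ hexp
  have hK : ExpSmall ρ ({p : Vec d × SymMatrix d | p.2.1.PosSemidef ∧
      (p.2.1 - outer p.1).PosSemidef ∧ p.2.1.trace ≤ R} ∩ A) := by
    refine ((isCompact_setOf_trace_le R).inter_right hA).induction_on (expSmall_empty ρ)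
      (fun _ _ hST h => h.mono hST) (fun _ _ hS hT => hS.union hT) fun p hp => ?_
    suffices h : ∃ V ∈ 𝓝 p, ExpSmall ρ V by
      obtain ⟨V, hV, hVs⟩ := h
      exact ⟨V, mem_nhdsWithin_of_mem_nhds hV, hVs⟩
    by_cases hpd : p.2.1.PosDef
    · by_cases hx : p.1 = 0
      · refine exists_expSmall_nhds_of_ne_covMatrix hmom hv₀ hexp hpd hx fun hM => h0 ?_
        rw [← hx, ← hM]
        exact hp.2
      · exact exists_expSmall_nhds_of_ne_zero hsymm hmom hcov hpd hx
    · exact exists_expSmall_nhds_of_not_posDef hH hpd hp.1.1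
  obtain ⟨δ, hδ, C, hC⟩ := hK.union hR
  refine ⟨δ, hδ, C, fun n hn => (lintegral_mono_set fun p hp => ?_).trans (hC n hn)⟩
  refine ⟨hp.1, ?_⟩
  by_cases h : p.2.1.trace ≤ R
  · exact Or.inl ⟨⟨hp.1.1.posSemidef, hp.1.2, h⟩, hp.2⟩
  · exact Or.inr (not_le.1 h)

/-! ### Lower bound on the normalization. -/

theorem span_support_eq_top {ρ : Measure (Vec d)}
    (hmom : Integrable (fun z => ‖z‖ ^ 2) ρ) (hcov : (covMatrix ρ).1.PosDef) :
    Submodule.span ℝ ρ.support = ⊤ := by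
  rw [← Submodule.orthogonal_eq_bot_iff, Submodule.eq_bot_iff]
  intro w hw
  by_contra hw0
  refine measure_dotProduct_ne_zero hmom hcov (u := w.ofLp)
    (fun h => hw0 (WithLp.ofLp_injective 2 h)) ?_
  change ∀ᵐ z ∂ρ, w.ofLp ⬝ᵥ z.ofLp = 0
  filter_upwards [Measure.support_mem_ae (μ := ρ)] with z hz
  have := (Submodule.mem_orthogonal _ w).1 hw z (Submodule.subset_span hz)
  simpa [EuclideanSpace.inner_eq_star_dotProduct] using this

theorem exists_mem_nondegenerateSet {ρ : Measure (Vec d)}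
    (hmom : Integrable (fun z => ‖z‖ ^ 2) ρ) (hcov : (covMatrix ρ).1.PosDef) :
    ∃ v : Fin d → Vec d, (∀ i, v i ∈ ρ.support) ∧ v ∈ nondegenerateSet d d := by
  have htop := span_support_eq_top hmom hcov
  obtain ⟨f, hf, hspan, -⟩ := Submodule.exists_fun_fin_finrank_span_eq ℝ ρ.support
  have hd : Module.finrank ℝ (Submodule.span ℝ ρ.support) = d := by
    rw [htop, finrank_top, finrank_euclideanSpace_fin]
  refine ⟨fun i => f (Fin.cast hd.symm i), fun i => hf _, mem_nondegenerateSet_iff.2 ?_⟩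
  intro w hw
  by_contra! h
  have hmem : WithLp.toLp 2 w ∈ (Submodule.span ℝ (Set.range f))ᗮ := by
    rw [Submodule.mem_orthogonal]
    intro z hz
    induction hz using Submodule.span_induction with
    | mem z hz =>
      obtain ⟨i, rfl⟩ := hz
      simpa [EuclideanSpace.inner_eq_star_dotProduct] using h (Fin.cast hd i)
    | zero => simp
    | add y z _ _ hy hz => rw [inner_add_left, hy, hz, add_zero]
    | smul a z _ hz => rw [inner_smul_left, hz, mul_zero]
  rw [hspan, htop, Submodule.top_orthogonal_eq_bot, Submodule.mem_bot] at hmem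
  exact hw (congrArg WithLp.ofLp hmem)

theorem isOpen_nondegenerateSet : IsOpen (nondegenerateSet d n) :=
  isOpen_lt continuous_const continuous_sumOuter.matrix_det

theorem append_mem_nondegenerateSet {m : ℕ} {x : Fin (d + m) → Vec d}
    (h : (fun i => x (Fin.castAdd m i)) ∈ nondegenerateSet d d) :
    x ∈ nondegenerateSet d (d + m) := by
  rw [mem_nondegenerateSet_iff] at h ⊢
  intro w hw
  obtain ⟨i, hi⟩ := h w hw
  exact ⟨_, hi⟩

/-- A basis chosen in the support has a product neighbourhood inside the open set `D_d⁺`. Its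
positive mass serves for every `n ≥ d`, since further vectors cannot destroy nondegeneracy. -/
theorem exists_le_measure_nondegenerateSet {ρ : Measure (Vec d)} [IsProbabilityMeasure ρ]
    (hmom : Integrable (fun z => ‖z‖ ^ 2) ρ) (hcov : (covMatrix ρ).1.PosDef) :
    ∃ c : NNReal, 0 < c ∧ ∀ n, d ≤ n →
      c ≤ (Measure.pi fun _ : Fin n => ρ) (nondegenerateSet d n) := by
  obtain ⟨v, hv, hvD⟩ := exists_mem_nondegenerateSet hmom hcov
  obtain ⟨U, hU, hUD⟩ := isOpen_pi_iff'.1 isOpen_nondegenerateSet v hvD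
  have hpos (i : Fin d) : 0 < ρ (U i) :=
    Measure.mem_support_iff_forall (v i) |>.1 (hv i) _ ((hU i).1.mem_nhds (hU i).2)
  refine ⟨∏ i, (ρ (U i)).toNNReal, Finset.prod_pos fun i _ =>
    ENNReal.toNNReal_pos (hpos i).ne' (measure_ne_top _ _), fun n hn => ?_⟩
  obtain ⟨m, rfl⟩ := Nat.exists_eq_add_of_le hn
  have hsub : Set.univ.pi (Fin.append U fun _ : Fin m => Set.univ) ⊆ nondegenerateSet d (d + m) := by
    intro x hx
    refine append_mem_nondegenerateSet (hUD fun i _ => ?_)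
    simpa using hx (Fin.castAdd m i) (Set.mem_univ _)
  refine le_trans (le_of_eq ?_) (measure_mono hsub)
  rw [Measure.pi_pi, Fin.prod_univ_add, ENNReal.ofNNReal_finsetProd]
  simp

theorem one_le_weight {x : Fin n → Vec d} (hx : x ∈ nondegenerateSet d n) : 1 ≤ weight x := by
  have h := ((posDef_iff_det_pos (posSemidef_sumOuter x)).2 hx).inv.posSemidef
  have h1 : 0 ≤ invQuad (sumOuter x) (sumVec x) := by
    rw [invQuad, dotProduct_comm]
    simpa using h.dotProduct_mulVec_nonneg (sumVec x).ofLp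
  rw [weight, ENNReal.one_le_ofReal]
  exact Real.one_le_exp (by linarith)

theorem measure_nondegenerateSet_le_partitionFunction (ρ : Measure (Vec d)) [SigmaFinite ρ]
    (n : ℕ) : (Measure.pi fun _ : Fin n => ρ) (nondegenerateSet d n) ≤ partitionFunction ρ n := by
  rw [← setLIntegral_one]
  exact setLIntegral_mono' isOpen_nondegenerateSet.measurableSet fun x hx => one_le_weight hx

/-! ### Logarithmic rates and transfer to the model law. -/

theorem liminf_log_partitionFunction_nonneg {Z : ℕ → ENNReal} {c : NNReal} (hc : 0 < c)
    (h : ∀ᶠ n in atTop, c ≤ Z n) :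
    0 ≤ liminf (fun n : ℕ => ENNReal.log (Z n) / (n : EReal)) atTop := by
  have hlim : Tendsto (fun n : ℕ => ((Real.log c / n : ℝ) : EReal)) atTop (𝓝 0) := by
    exact_mod_cast (continuous_coe_real_ereal.tendsto 0).comp
      (tendsto_const_div_atTop_nhds_zero_nat (Real.log c))
  rw [← hlim.liminf_eq]
  refine liminf_le_liminf ?_
  filter_upwards [h] with n hn
  rw [EReal.coe_div, EReal.coe_coe_eq_natCast]
  refine EReal.div_le_div_right_of_nonneg (by positivity) ?_
  rw [← ENNReal.log_of_nnreal hc.ne']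
  exact ENNReal.log_monotone hn

theorem limsup_log_neg {I : ℕ → ENNReal} {δ : ℝ} (hδ : 0 < δ)
    (h : ∀ᶠ n : ℕ in atTop, I n ≤ ENNReal.ofReal (Real.exp (-(n * δ)))) :
    limsup (fun n : ℕ => ENNReal.log (I n) / (n : EReal)) atTop < 0 := by
  refine lt_of_le_of_lt (b := ((-δ : ℝ) : EReal)) ?_ (by exact_mod_cast neg_lt_zero.2 hδ)
  refine limsup_le_of_le (by isBoundedDefault) ?_
  filter_upwards [h, eventually_gt_atTop 0] with n hn hn0
  have hn0' : (n : ℝ) ≠ 0 := by positivity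
  have h1 := ENNReal.log_monotone hn
  rw [ENNReal.log_ofReal_of_pos (Real.exp_pos _), Real.log_exp] at h1
  refine (EReal.div_le_div_right_of_nonneg (by positivity) h1).trans (le_of_eq ?_)
  rw [← EReal.coe_coe_eq_natCast, ← EReal.coe_div]
  congr 1
  field_simp

theorem ExpSmall.eventually_le {ρ : Measure (Vec d)} {S : Set (Vec d × SymMatrix d)}
    (h : ExpSmall ρ S) (K : NNReal) : ∃ ε : ℝ, 0 < ε ∧
      ∀ᶠ n : ℕ in atTop, K * deltaIntegral ρ n S ≤ ENNReal.ofReal (Real.exp (-(n * ε))) := by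
  obtain ⟨δ, hδ, C, hC⟩ := h
  -- The other half of the rate absorbs the constant `K * C`.
  refine ⟨δ / 2, half_pos hδ, ?_⟩
  have hlim : Tendsto (fun n : ℕ => Real.exp (n * (δ / 2))) atTop atTop :=
    Real.tendsto_exp_atTop.comp (tendsto_natCast_atTop_atTop.atTop_mul_const (half_pos hδ))
  filter_upwards [hlim.eventually_ge_atTop (K * C), eventually_ne_atTop 0] with n hn hn0
  calc K * deltaIntegral ρ n S ≤ K * (C * ENNReal.ofReal (Real.exp (-(n * δ)))) := by
        gcongr; exact hC n hn0
    _ = ENNReal.ofReal (K * C * Real.exp (-(n * δ))) := by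
        rw [ENNReal.ofReal_mul (by positivity), ENNReal.ofReal_mul (by positivity),
          ENNReal.ofReal_coe_nnreal, ENNReal.ofReal_coe_nnreal, mul_assoc]
    _ ≤ ENNReal.ofReal (Real.exp (n * (δ / 2)) * Real.exp (-(n * δ))) := by gcongr
    _ = _ := by
        rw [← Real.exp_add]
        congr 2
        ring

theorem modelLaw_le (ρ : Measure (Vec d)) (hn : n ≠ 0) {A : Set (Vec d × SymMatrix d)}
    (hA : MeasurableSet A) :
    modelLaw ρ n {x | empiricalPair x ∈ A} ≤ (partitionFunction ρ n)⁻¹ * deltaIntegral ρ n A := by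
  have hms : MeasurableSet {x : Fin n → Vec d | empiricalPair x ∈ A} :=
    continuous_empiricalPair.measurable hA
  have hf : Measurable fun p : Vec d × SymMatrix d =>
      ENNReal.ofReal (Real.exp (n * invQuad p.2.1 p.1 / 2)) := by
    have := measurable_invQuad (d := d)
    fun_prop
  have hfe : Measurable fun x : Fin n → Vec d => ENNReal.ofReal (Real.exp
      (n * invQuad (empiricalPair x).2.1 (empiricalPair x).1 / 2)) :=
    hf.comp (continuous_empiricalPair (d := d) (n := n)).measurable
  rw [deltaIntegral, empiricalLaw, setLIntegral_map (measurableSet_deltaStar.inter hA) hf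
    continuous_empiricalPair.measurable, ← lintegral_const_mul _ hfe, modelLaw,
    withDensity_apply _ hms, Measure.restrict_restrict hms]
  calc _ ≤ ∫⁻ x in {x | empiricalPair x ∈ A} ∩ nondegenerateSet d n,
        (partitionFunction ρ n)⁻¹ * ENNReal.ofReal (Real.exp
          (n * invQuad (empiricalPair x).2.1 (empiricalPair x).1 / 2)) ∂_ := by
        refine setLIntegral_mono (hfe.const_mul _) fun x hx => ?_
        rw [weight, invQuad_empiricalPair hn hx.2, ENNReal.div_eq_inv_mul]
    _ ≤ _ := by
        refine lintegral_mono_set fun x hx => ?_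
        exact ⟨empiricalPair_mem_deltaStar hn x hx.2, hx.1⟩

end CurieWeissSOC
end

theorem proposition3 (d : ℕ) (hd : 1 ≤ d)
    (ρ : Measure (CurieWeissSOC.Vec d)) [IsProbabilityMeasure ρ]
    (hsymm : ρ.map (fun z => -z) = ρ)
    (hmom : Integrable (fun z => ‖z‖ ^ 2) ρ)
    (hcov : (CurieWeissSOC.covMatrix ρ).1.PosDef) :
    0 ≤ liminf (fun n : ℕ =>
        ENNReal.log (CurieWeissSOC.partitionFunction ρ n) / (n : EReal)) atTop ∧
    ((∃ v₀ : ℝ, 0 < v₀ ∧ Integrable (fun z => Real.exp (v₀ * ‖z‖ ^ 2)) ρ) →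
      (∀ H : Submodule ℝ (CurieWeissSOC.Vec d), Module.finrank ℝ H + 1 = d →
        ρ (H : Set (CurieWeissSOC.Vec d)) < ENNReal.ofReal (1 / √(Real.exp 1))) →
      (∀ A : Set (CurieWeissSOC.Vec d × CurieWeissSOC.SymMatrix d), IsClosed A →
        ((0 : CurieWeissSOC.Vec d), CurieWeissSOC.covMatrix ρ) ∉ A →
        limsup (fun n : ℕ =>
          ENNReal.log (∫⁻ p in CurieWeissSOC.deltaStar d ∩ A,
            ENNReal.ofReal (Real.exp (n * CurieWeissSOC.invQuad p.2.1 p.1 / 2))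
              ∂(CurieWeissSOC.empiricalLaw ρ n)) / (n : EReal)) atTop < 0) ∧
      (∀ U : Set (CurieWeissSOC.Vec d × CurieWeissSOC.SymMatrix d), IsOpen U →
        ((0 : CurieWeissSOC.Vec d), CurieWeissSOC.covMatrix ρ) ∈ U →
        ∃ ε : ℝ, 0 < ε ∧ ∃ n₀ : ℕ, ∀ n : ℕ, n₀ ≤ n →
          CurieWeissSOC.modelLaw ρ n {x | CurieWeissSOC.empiricalPair x ∉ U} ≤
            ENNReal.ofReal (Real.exp (-(n * ε))))) := by
  obtain ⟨c, hc, hcn⟩ := CurieWeissSOC.exists_le_measure_nondegenerateSet hmom hcov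
  have hZ (n : ℕ) (hn : d ≤ n) : (c : ENNReal) ≤ CurieWeissSOC.partitionFunction ρ n :=
    (hcn n hn).trans (CurieWeissSOC.measure_nondegenerateSet_le_partitionFunction ρ n)
  refine ⟨CurieWeissSOC.liminf_log_partitionFunction_nonneg hc
    (eventually_atTop.2 ⟨d, hZ⟩), ?_⟩
  rintro ⟨v₀, hv₀, hexp⟩ hH
  refine ⟨fun A hA h0 => ?_, fun U hU h0 => ?_⟩
  · obtain ⟨ε, hε, h⟩ := (CurieWeissSOC.expSmall_of_isClosed hsymm hmom hcov hv₀ hexp hH hA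
      h0).eventually_le 1
    exact CurieWeissSOC.limsup_log_neg hε (by simpa [CurieWeissSOC.deltaIntegral] using h)
  -- The factor `c⁻¹` bounds `Z_n⁻¹` once `n ≥ d`.
  · obtain ⟨ε, hε, h⟩ := (CurieWeissSOC.expSmall_of_isClosed hsymm hmom hcov hv₀ hexp hH
      hU.isClosed_compl (fun h => h h0)).eventually_le c⁻¹
    obtain ⟨n₀, hn₀⟩ := eventually_atTop.1 h
    refine ⟨ε, hε, max n₀ d, fun n hn => ?_⟩
    have hdn := (le_max_right _ _).trans hn
    refine (CurieWeissSOC.modelLaw_le ρ (by omega) hU.isClosed_compl.measurableSet).trans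
      (le_trans ?_ (hn₀ n ((le_max_left _ _).trans hn)))
    rw [ENNReal.coe_inv hc.ne']
    gcongr
    exact hZ n hdn
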